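/- Let $T$ be a complete first-order theory which is small, i.e. has only countably many complete types over $\varnothing$ in each finite number of variables, let $n\in\mathbb N$, and let $p(x)$, $x=(x_1,\dots,x_n)$, be a complete $n$-type of $T$. *Isolation.* For a tuple $a$ of a model $M\models T$, a formula $\varphi(a,y)$ is principal if it is consistent and for every formula $\psi(x,y)$ either $\varphi(a,y)\vdash\psi(a,y)$ or $\varphi(a,y)\vdash\neg\psi(a,y)$. The tuple $a$ isolates $b$ if there is a principal formula $\varphi(a,y)$ satisfied by $b$ with $\varphi(a,y)\vdash\mathrm{tp}(b)$. In a model $M\models T$, $I_p$ is the relation "$a$ isolates $b$" on the set of realizations of $p$ in $M$. *Labels.* Let $\mathrm{PF}(p)$ be the set of formulas $\varphi(x,y)$ such that, for $a\models p$, $\varphi(a,y)$ is principal and $\varphi(a,y)\vdash p(y)$. Let $\mathrm{PE}(p)$ identify $\varphi,\psi\in\mathrm{PF}(p)$ when $\varphi(a,y)$ and $\psi(a,y)$ have the same solutions for $a\models p$. Let $\mathrm{PFS}(p)$ be the set of those $\mathrm{PE}(p)$-classes that contain a formula $\varphi$ for which there are $a\models p$ and $b$ with $\models\varphi(a,b)$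 and $\varphi(x,b)$ principal over $b$ (principal edges), and $\mathrm{PFN}(p)$ the set of those classes that contain a formula $\varphi$ for which there are $a\models p$ and $b$ with $\models\varphi(a,b)$ such that $b$ does not isolate $a$ (irreversible principal arcs). Let $U=U^-\,\dot\cup\,\{0\}\,\dot\cup\,U^+$ be a set of negative, zero and positive labels, and let $\nu(p):\mathrm{PF}(p)/\mathrm{PE}(p)\to U$ be a regular labelling function, i.e. an injective map sending $\mathrm{PFN}(p)$ into $U^-$, $\mathrm{PFS}(p)$ into $U^{\ge 0}=\{0\}\cup U^+$, and the class of $x\approx y$ to $0$. Let $\rho_{\nu(p)}$ be its image and, for $u\in\rho_{\nu(p)}$, let $\theta_u(x,y)\in\mathrm{PF}(p)$ be a formula with label $u$. *The structure $\mathfrak P_{\nu(p)}$.* For $u_1,u_2\in\rho_{\nu(p)}$ let $\lfloor u_1,u_2\rfloor$ be the set of $u\in\rho_{\nu(p)}$ such that $\theta_u(a,y)\vdash\exists z\,(\theta_{u_1}(a,z)\wedge\theta_{u_2}(z,y))$ for $a\models p$; for sets of labels put $\lfloor X_1,X_2\rfloor=\bigcup\{\lfloor u_1,u_2\rfloor\mid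 u_1\in X_1,u_2\in X_2\}$. Then $\mathfrak P_{\nu(p)}=\langle\mathcal P(\rho_{\nu(p)})\setminus\{\varnothing\};\lfloor\cdot,\cdot\rfloor\rangle$. It is almost deterministic if $\lfloor u_1,u_2\rfloor$ is nonempty and finite for all $u_1,u_2\in\rho_{\nu(p)}$; it is a monoid if the nonempty subsets of $\rho_{\nu(p)}$ are closed under $\lfloor\cdot,\cdot\rfloor$ and the operation on them is associative and has a unit. *Limit models.* A model $M$ is prime over a tuple $c\in M$ if, whenever a tuple $d$ of a model $N$ has the same type as $c$, there is an elementary embedding $M\to N$ taking $c$ to $d$. A countable model $M$ of $T$ is limit over $p$ if $M$ is not prime over any finite tuple and $M=\bigcup_{k\in\omega}M_k$ for an elementary chain $(M_k)_{k\in\omega}$ in which each $M_k$ is prime over some realization $a_k\in M_k$ of $p$. Then the following conditions are equivalent: 1. in every model $M\models T$, $I_p$ is an equivalence relation on the set of realizations of $p$ in $M$; 2. $\mathfrak P_{\nu(p)}$ is an almost deterministic monoid and there are no limit models over $p$; 3. $\mathfrak P_{\nu(p)}$ is an almost deterministic monoid and consists of non-negative labels, i.e. $\rho_{\nu(p)}\subseteq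 U^{\ge 0}$. -/

import Mathlib

open FirstOrder

universe u v w

namespace IsolatingFormulas

open FirstOrder.Language

/-- A theory is small if it has only countably many complete types over the empty set
(in all finite tuples of variables). -/
def IsSmall {L : FirstOrder.Language.{u, v}} (T : L.Theory) : Prop :=
  ∀ n : ℕ, Countable (T.CompleteType (Fin n))

section Principal

variable {L : FirstOrder.Language.{u, v}} {M : Type w} [L.Structure M] {m n : ℕ}

/-- `M ⊨ φ(a, b)`, where the variables of `φ(x, y)` are split as `x = (x₁, …, xₘ)` and
`y = (y₁, …, yₙ)`. -/
def Holds (φ : L.Formula (Fin m ⊕ Fin n)) (a : Fin m → M) (b : Fin n → M) : Prop :=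
  φ.Realize (Sum.elim a b)

/-- The formula `φ(a, y)` is principal (isolating) over `a`: it is consistent and decides every
formula `ψ(a, y)`. Both properties are expressed by first-order formulas of `a`, so they may be
evaluated in the model `M` containing `a`. -/
def IsPrincipal (φ : L.Formula (Fin m ⊕ Fin n)) (a : Fin m → M) : Prop :=
  (∃ b : Fin n → M, Holds φ a b) ∧
    ∀ ψ : L.Formula (Fin m ⊕ Fin n),
      (∀ b : Fin n → M, Holds φ a b → Holds ψ a b) ∨
        (∀ b : Fin n → M, Holds φ a b → ¬ Holds ψ a b)

/-- The tuple `a` isolates the tuple `b`: some principal formula `φ(a, y)` belongs to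
`tp(b/a)` and satisfies `φ(a, y) ⊢ tp(b)`. -/
def Isolates (L : FirstOrder.Language.{u, v}) {M : Type w} [L.Structure M] {m n : ℕ}
    (a : Fin m → M) (b : Fin n → M) : Prop :=
  ∃ φ : L.Formula (Fin m ⊕ Fin n), IsPrincipal φ a ∧ Holds φ a b ∧
    ∀ ψ : L.Formula (Fin n), ψ.Realize b → ∀ c : Fin n → M, Holds φ a c → ψ.Realize c

/-- `φ(y, x)`. -/
def swap (φ : L.Formula (Fin m ⊕ Fin n)) : L.Formula (Fin n ⊕ Fin m) :=
  φ.relabel Sum.swap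

/-- The formula `x ≈ y`. -/
noncomputable def eqFormula (L : FirstOrder.Language.{u, v}) (n : ℕ) : L.Formula (Fin n ⊕ Fin n) :=
  Formula.iInf fun i : Fin n =>
    ((Term.var (Sum.inl i) : L.Term (Fin n ⊕ Fin n)).equal (Term.var (Sum.inr i)))

/-- The formula `∃ z (φ(x, z) ∧ ψ(z, y))`. -/
noncomputable def comp (φ ψ : L.Formula (Fin n ⊕ Fin n)) : L.Formula (Fin n ⊕ Fin n) :=
  Formula.iExs (β := Fin n)
    (φ.relabel (Sum.elim (fun i => Sum.inl (Sum.inl i)) (fun i => Sum.inr i)) ⊓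
      ψ.relabel (Sum.elim (fun i => Sum.inr i) (fun i => Sum.inl (Sum.inr i))) :
      L.Formula ((Fin n ⊕ Fin n) ⊕ Fin n))

theorem holds_swap (φ : L.Formula (Fin m ⊕ Fin n)) (a : Fin m → M) (b : Fin n → M) :
    Holds (swap φ) b a ↔ Holds φ a b := by
  simp only [Holds, swap, Formula.realize_relabel]
  have h : (Sum.elim b a ∘ Sum.swap : Fin m ⊕ Fin n → M) = Sum.elim a b := by
    funext i; cases i <;> rfl
  rw [h]

theorem holds_eqFormula (a b : Fin n → M) : Holds (eqFormula L n) a b ↔ a = b := by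
  simp [Holds, eqFormula, Formula.realize_iInf, Formula.realize_equal, funext_iff]

theorem holds_comp (φ ψ : L.Formula (Fin n ⊕ Fin n)) (a b : Fin n → M) :
    Holds (comp φ ψ) a b ↔ ∃ c : Fin n → M, Holds φ a c ∧ Holds ψ c b := by
  simp only [Holds, comp, Formula.realize_iExs, Formula.realize_inf, Formula.realize_relabel]
  refine exists_congr fun c => ?_
  have h₁ : (Sum.elim (Sum.elim a b) c ∘
      Sum.elim (fun i => Sum.inl (Sum.inl i)) (fun i => Sum.inr i) : Fin n ⊕ Fin n → M) =
        Sum.elim a c := by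
    funext i; cases i <;> rfl
  have h₂ : (Sum.elim (Sum.elim a b) c ∘
      Sum.elim (fun i => Sum.inr i) (fun i => Sum.inl (Sum.inr i)) : Fin n ⊕ Fin n → M) =
        Sum.elim c b := by
    funext i; cases i <;> rfl
  rw [h₁, h₂]

end Principal

section Models

/-- `M` is prime over the tuple `c`: whenever a tuple `d` of a structure `N` has the same type as
`c` (in particular `N` has the same theory as `M`), the map `c ↦ d` extends to an elementary
embedding of `M` into `N`. -/
def IsPrimeOver (L : FirstOrder.Language.{u, v}) {M : Type w} [L.Structure M] {k : ℕ}
    (c : Fin k → M) : Prop :=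
  ∀ (N : Type w) [L.Structure N] (d : Fin k → N),
    (∀ φ : L.Formula (Fin k), φ.Realize c ↔ φ.Realize d) →
      ∃ f : M ↪ₑ[L] N, ∀ i, f (c i) = d i

/-- `M` is a limit model over the type `p`: it is countable, it is not prime over any finite tuple,
and it is the union of an elementary chain of models `S k`, each of them prime over a realization
of `p`. -/
def IsLimitOver {L : FirstOrder.Language.{u, v}} {T : L.Theory} {n : ℕ} (p : T.CompleteType (Fin n))
    (M : Type w) [L.Structure M] [Nonempty M] [M ⊨ T] : Prop :=
  Countable M ∧
    (∀ (k : ℕ) (c : Fin k → M), ¬ IsPrimeOver L c) ∧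
      ∃ S : ℕ → L.ElementarySubstructure M, Monotone S ∧ (∀ x : M, ∃ k, x ∈ S k) ∧
        ∀ k : ℕ, ∃ a : Fin n → S k,
          T.typeOf (fun i => (a i : M)) = p ∧ IsPrimeOver L a

end Models

section Labels

variable {L : FirstOrder.Language.{u, v}} {T : L.Theory} {n : ℕ}

/-- The relation `I_p` of isolation on the set of realizations of `p` in the model `M`. -/
def isolationRel (p : T.CompleteType (Fin n)) (M : Type w) [L.Structure M] [Nonempty M] [M ⊨ T]
    (a b : {a : Fin n → M // T.typeOf a = p}) : Prop :=
  Isolates L a.1 b.1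

/-- `PF(p)`: the formulas `φ(x, y)` such that, for `a` realizing `p`, the formula `φ(a, y)` is
principal and `φ(a, y) ⊢ p(y)`. -/
def PF (p : T.CompleteType (Fin n)) : Set (L.Formula (Fin n ⊕ Fin n)) :=
  {φ | ∀ (M : Theory.ModelType.{u, v, max u v} T) (a : Fin n → M), T.typeOf a = p →
    IsPrincipal φ a ∧ ∀ b : Fin n → M, Holds φ a b → T.typeOf b = p}

/-- `PE(p)`: two formulas of `PF(p)` are identified when `φ(a, y)` and `ψ(a, y)` have the same
solutions for `a` realizing `p`. -/
def PE (p : T.CompleteType (Fin n)) : Setoid (PF p) where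
  r φ ψ := ∀ (M : Theory.ModelType.{u, v, max u v} T) (a : Fin n → M), T.typeOf a = p →
    ∀ b : Fin n → M, Holds φ.1 a b ↔ Holds ψ.1 a b
  iseqv :=
    ⟨fun _ _ _ _ _ => Iff.rfl, fun h M a ha b => (h M a ha b).symm,
      fun h₁ h₂ M a ha b => (h₁ M a ha b).trans (h₂ M a ha b)⟩

/-- The quotient `PF(p)/PE(p)`. -/
abbrev PFClass (p : T.CompleteType (Fin n)) : Type (max u v) := Quotient (PE p)

/-- The classes corresponding to principal edges: some formula `φ` of the class has an arc `(a, b)`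
for which `φ(x, b)` is principal over `b`. -/
def PFS (p : T.CompleteType (Fin n)) : Set (PFClass p) :=
  {E | ∃ φ : PF p, Quotient.mk (PE p) φ = E ∧
    ∃ (M : Theory.ModelType.{u, v, max u v} T) (a b : Fin n → M),
      T.typeOf a = p ∧ Holds φ.1 a b ∧ IsPrincipal (swap φ.1) b}

/-- The classes corresponding to irreversible principal arcs: some formula `φ` of the class has
an arc `(a, b)` for which `(b, a)` is not a principal arc on any formula. -/
def PFN (p : T.CompleteType (Fin n)) : Set (PFClass p) :=
  {E | ∃ φ : PF p, Quotient.mk (PE p) φ = E ∧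
    ∃ (M : Theory.ModelType.{u, v, max u v} T) (a b : Fin n → M),
      T.typeOf a = p ∧ Holds φ.1 a b ∧ ¬ Isolates L b a}

theorem eqFormula_mem_PF (p : T.CompleteType (Fin n)) : eqFormula L n ∈ PF p := by
  intro M a ha
  refine ⟨⟨⟨a, (holds_eqFormula a a).2 rfl⟩, fun ψ => ?_⟩, fun b hb => ?_⟩
  · by_cases h : Holds ψ a a
    · exact Or.inl fun b hb => by rwa [← (holds_eqFormula a b).1 hb]
    · exact Or.inr fun b hb => by rwa [← (holds_eqFormula a b).1 hb]
  · rwa [← (holds_eqFormula a b).1 hb]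

/-- An alphabet of labels: a set `U` that is the disjoint union of a set of negative elements,
a one-element set `{0}`, and a set of positive elements. -/
structure LabelAlphabet (U : Type w) where
  neg : Set U
  zero : U
  pos : Set U
  zero_notMem_neg : zero ∉ neg
  zero_notMem_pos : zero ∉ pos
  disjoint_neg_pos : Disjoint neg pos
  cover : ∀ x : U, x ∈ neg ∨ x = zero ∨ x ∈ pos

/-- The set of non-negative labels. -/
def LabelAlphabet.nonneg {U : Type w} (A : LabelAlphabet U) : Set U := {A.zero} ∪ A.pos

/-- A regular labelling function `ν(p) : PF(p)/PE(p) → U`. -/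
structure RegularLabelling (p : T.CompleteType (Fin n)) {U : Type w} (A : LabelAlphabet U) where
  toFun : PFClass p → U
  injective : Function.Injective toFun
  map_PFN : ∀ E ∈ PFN p, toFun E ∈ A.neg
  map_PFS : ∀ E ∈ PFS p, toFun E ∈ A.nonneg
  map_eq : toFun (Quotient.mk (PE p) ⟨eqFormula L n, eqFormula_mem_PF p⟩) = A.zero

namespace RegularLabelling

variable {p : T.CompleteType (Fin n)} {U : Type w} {A : LabelAlphabet U}

/-- `ρ_{ν(p)}`: the set of labels that are used. -/
def rho (ν : RegularLabelling p A) : Set U := Set.range ν.toFun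

/-- `θ_u(x, y)`: a formula of `PF(p)` with the label `u`. -/
noncomputable def theta (ν : RegularLabelling p A) (u : ν.rho) : L.Formula (Fin n ⊕ Fin n) :=
  (Quotient.out (Classical.choose u.2)).1

/-- `⌊u₁, u₂⌋`: the set of labels `u` such that
`θ_u(a, y) ⊢ ∃ z (θ_{u₁}(a, z) ∧ θ_{u₂}(z, y))` for `a` realizing `p`. -/
def bracket (ν : RegularLabelling p A) (u₁ u₂ : ν.rho) : Set ν.rho :=
  {t | ∀ (M : Theory.ModelType.{u, v, max u v} T) (a : Fin n → M), T.typeOf a = p →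
    ∀ b : Fin n → M, Holds (ν.theta t) a b → Holds (comp (ν.theta u₁) (ν.theta u₂)) a b}

/-- The operation `⌊X₁, X₂⌋ = ⋃ {⌊u₁, u₂⌋ | u₁ ∈ X₁, u₂ ∈ X₂}` on sets of labels. -/
def mul (ν : RegularLabelling p A) (X Y : Set ν.rho) : Set ν.rho :=
  {t | ∃ u₁ ∈ X, ∃ u₂ ∈ Y, t ∈ ν.bracket u₁ u₂}

/-- The structure `𝔓_{ν(p)}`, the nonempty subsets of `ρ_{ν(p)}` with the operation `⌊·,·⌋`,
is almost deterministic. -/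
def IsAlmostDeterministic (ν : RegularLabelling p A) : Prop :=
  ∀ u₁ u₂ : ν.rho, (ν.bracket u₁ u₂).Nonempty ∧ (ν.bracket u₁ u₂).Finite

/-- The structure `𝔓_{ν(p)}` is a monoid: the nonempty subsets of `ρ_{ν(p)}` are closed under
the operation, which is associative and has a unit on them. -/
def IsMonoid (ν : RegularLabelling p A) : Prop :=
  (∀ X Y : Set ν.rho, X.Nonempty → Y.Nonempty → (ν.mul X Y).Nonempty) ∧
    (∀ X Y Z : Set ν.rho, X.Nonempty → Y.Nonempty → Z.Nonempty →
      ν.mul (ν.mul X Y) Z = ν.mul X (ν.mul Y Z)) ∧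
    ∃ e : Set ν.rho, e.Nonempty ∧
      ∀ X : Set ν.rho, X.Nonempty → ν.mul e X = X ∧ ν.mul X e = X

end RegularLabelling

end Labels

end IsolatingFormulas

/-!
Everything rests on one observation: `a` isolates `b` exactly when `tp(b/a)` is an isolated type
(`isolates_iff`), and isolated types over finite tuples are dense because `T` is small
(`IsSmall.exists_isolatesBy`, by the Baire category theorem in a countable Stone space).

*Transitivity corresponds to the algebra of labels.* Two realizations `a`, `b` of `p` with `a`
isolating `b` carry a unique label, and membership in a bracket can be tested on one arc. So
transitivity of `I_p` says that the composition of two labelled arcs is a labelled arc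
(`ArcsCompose`). Compactness then makes the brackets finite, and the monoid laws are inherited from
the composition of relations. Conversely, if the brackets are finite, then `θ_{u₁} ∘ θ_{u₂}` is the
disjunction of the formulas with labels in `⌊u₁, u₂⌋`, since otherwise the density of isolated types
would produce a further label.

*Symmetry corresponds to non-negative labels.* All arcs with a given label have the same type, so
either all of them can be reversed, and the class of formulas lies in `PFS(p)`, or none can, and it
lies in `PFN(p)` (`RegularLabelling.rho_subset_nonneg_iff`).

*Symmetry corresponds to the absence of limit models.* Over every finite tuple of a model there is a
countable atomic elementary submodel (`IsSmall.exists_countable_atomic`), countable atomic models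
are prime (`IsAtomicOver.isPrimeOver`), and hence prime models are atomic
(`IsPrimeOver.isAtomicOver`). Atomicity over `c` passes to atomicity over `a` when `a` isolates `c`
(`TypeIsolated.change_base`). If isolation is symmetric on realizations of `p`, a union of a chain
of models that are prime over realizations `a_k` of `p` is atomic over `a_0`, hence prime over it
when it is countable. If `a` isolates `b` but `b` does not isolate `a`, the countable atomic model
`N` over `a` has an elementary self-embedding taking `a` to a copy of `b`, and the direct limit of
`N → N → N → ⋯` is a limit model: if it were atomic over a tuple `c` of the `k`-th copy of `N`,
it would be atomic over the `k`-th copy of `a`, which does not isolate the `(k + 1)`-st.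
-/

namespace IsolatingFormulas

open FirstOrder.Language

/-! ### Equality of types and isolation over a tuple -/

section TypeIsolation

variable {L : FirstOrder.Language.{u, v}} {M N : Type*} [L.Structure M] [L.Structure N]
  {α β γ : Type}

/-- The tuples `v` and `w`, possibly in different structures, satisfy the same formulas. -/
def SameType (L : FirstOrder.Language.{u, v}) {M N : Type*} [L.Structure M] [L.Structure N]
    {α : Type} (v : α → M) (w : α → N) : Prop :=
  ∀ φ : L.Formula α, φ.Realize v ↔ φ.Realize w

/-- The formula `χ(a, y)` isolates `tp(b/a)`: it holds of `b` and implies every formula over `a`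
that holds of `b`. -/
def IsolatesBy (χ : L.Formula (α ⊕ β)) (a : α → M) (b : β → M) : Prop :=
  χ.Realize (Sum.elim a b) ∧ ∀ ψ : L.Formula (α ⊕ β), ψ.Realize (Sum.elim a b) →
    ∀ c, χ.Realize (Sum.elim a c) → ψ.Realize (Sum.elim a c)

/-- The type of `b` over `a` is isolated. The tuples may be indexed by arbitrary types, which makes
concatenation and reindexing of tuples painless. -/
def TypeIsolated (L : FirstOrder.Language.{u, v}) {M : Type*} [L.Structure M] {α β : Type}
    (a : α → M) (b : β → M) : Prop :=
  ∃ χ : L.Formula (α ⊕ β), IsolatesBy χ a b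

/-- `M` is atomic over the tuple `a`. -/
def IsAtomicOver (L : FirstOrder.Language.{u, v}) {M : Type*} [L.Structure M] {α : Type}
    (a : α → M) : Prop :=
  ∀ (k : ℕ) (d : Fin k → M), TypeIsolated L a d

theorem SameType.symm {v : α → M} {w : α → N} (h : SameType L v w) : SameType L w v :=
  fun φ => (h φ).symm

theorem SameType.trans {P : Type*} [L.Structure P] {v : α → M} {w : α → N} {x : α → P}
    (h : SameType L v w) (h' : SameType L w x) : SameType L v x :=
  fun φ => (h φ).trans (h' φ)

theorem SameType.comp {v : α → M} {w : α → N} (h : SameType L v w) (g : β → α) :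
    SameType L (v ∘ g) (w ∘ g) := fun φ => by
  simpa only [Formula.realize_relabel] using h (φ.relabel g)

theorem SameType.inl {a : α → M} {b : β → M} {a' : α → N} {b' : β → N}
    (h : SameType L (Sum.elim a b) (Sum.elim a' b')) : SameType L a a' := by
  simpa using h.comp Sum.inl

theorem SameType.inr {a : α → M} {b : β → M} {a' : α → N} {b' : β → N}
    (h : SameType L (Sum.elim a b) (Sum.elim a' b')) : SameType L b b' := by
  simpa using h.comp Sum.inr

theorem SameType.forall_iff [Finite β] {a : α → M} {a' : α → N} (h : SameType L a a')
    (φ : L.Formula (α ⊕ β)) :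
    (∀ b, φ.Realize (Sum.elim a b)) ↔ ∀ b, φ.Realize (Sum.elim a' b) := by
  have := h (φ.iAlls β)
  simp only [Formula.realize_iAlls] at this
  exact this

theorem SameType.exists_iff [Finite β] {a : α → M} {a' : α → N} (h : SameType L a a')
    (φ : L.Formula (α ⊕ β)) :
    (∃ b, φ.Realize (Sum.elim a b)) ↔ ∃ b, φ.Realize (Sum.elim a' b) := by
  simpa only [Formula.realize_iExs] using h (φ.iExs β)

theorem SameType.forall_imp_iff [Finite β] {a : α → M} {a' : α → N} (h : SameType L a a')
    (φ ψ : L.Formula (α ⊕ β)) :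
    (∀ b, φ.Realize (Sum.elim a b) → ψ.Realize (Sum.elim a b)) ↔
      ∀ b, φ.Realize (Sum.elim a' b) → ψ.Realize (Sum.elim a' b) := by
  simpa only [Formula.realize_imp] using h.forall_iff (φ.imp ψ)

theorem sameType_elementaryEmbedding (f : M ↪ₑ[L] N) (v : α → M) : SameType L v (f ∘ v) :=
  fun φ => (f.map_formula φ v).symm

theorem typeOf_eq_iff {T : L.Theory} [Nonempty M] [M ⊨ T] [Nonempty N] [N ⊨ T]
    {v : α → M} {w : α → N} : T.typeOf v = T.typeOf w ↔ SameType L v w := by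
  refine ⟨fun h φ => ?_, fun h => SetLike.ext fun φ => ?_⟩
  · rw [← Theory.CompleteType.formula_mem_typeOf (T := T), h,
      Theory.CompleteType.formula_mem_typeOf]
  · simpa only [Theory.CompleteType.mem_typeOf] using h _

/-- A formula isolating `tp(b/a)` determines the type of the pair, even after `a` is replaced by
a tuple of the same type in another structure. -/
theorem IsolatesBy.sameType [Finite β] {χ : L.Formula (α ⊕ β)} {a : α → M} {b : β → M}
    (h : IsolatesBy χ a b) {a' : α → N} {b' : β → N} (ha : SameType L a a')
    (hb : χ.Realize (Sum.elim a' b')) : SameType L (Sum.elim a b) (Sum.elim a' b') := by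
  have key : ∀ ψ : L.Formula (α ⊕ β), ψ.Realize (Sum.elim a b) → ψ.Realize (Sum.elim a' b') :=
    fun ψ hψ => (ha.forall_imp_iff χ ψ).1 (h.2 ψ hψ) b' hb
  refine fun ψ => ⟨key ψ, fun hψ => ?_⟩
  by_contra hn
  exact key ψ.not hn hψ

theorem IsolatesBy.transfer [Finite β] {χ : L.Formula (α ⊕ β)} {a : α → M} {b : β → M}
    (h : IsolatesBy χ a b) {a' : α → N} {b' : β → N}
    (hab : SameType L (Sum.elim a b) (Sum.elim a' b')) : IsolatesBy χ a' b' :=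
  ⟨(hab χ).1 h.1, fun ψ hψ => (hab.inl.forall_imp_iff χ ψ).1 (h.2 ψ ((hab ψ).2 hψ))⟩

theorem TypeIsolated.transfer [Finite β] {a : α → M} {b : β → M} (h : TypeIsolated L a b)
    {a' : α → N} {b' : β → N} (hab : SameType L (Sum.elim a b) (Sum.elim a' b')) :
    TypeIsolated L a' b' :=
  h.imp fun _ hχ => hχ.transfer hab

theorem typeIsolated_map_iff [Finite β] (f : M ↪ₑ[L] N) {a : α → M} {b : β → M} :
    TypeIsolated L (f ∘ a) (f ∘ b) ↔ TypeIsolated L a b := by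
  have h : SameType L (Sum.elim a b) (Sum.elim (f ∘ a) (f ∘ b)) := by
    simpa only [Sum.comp_elim] using sameType_elementaryEmbedding f (Sum.elim a b)
  exact ⟨fun h' => h'.transfer h.symm, fun h' => h'.transfer h⟩

/-- Passing to a subtuple preserves isolation. -/
theorem TypeIsolated.comp [Finite β] [Finite γ] {a : α → M} {b : β → M}
    (h : TypeIsolated L a b) (g : γ → β) : TypeIsolated L a (b ∘ g) := by
  obtain ⟨χ, hχ⟩ := h
  let eqs : L.Formula ((α ⊕ γ) ⊕ β) := Formula.iInf fun j : γ =>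
    (Term.var (Sum.inl (Sum.inr j)) : L.Term ((α ⊕ γ) ⊕ β)).equal (Term.var (Sum.inr (g j)))
  let χ' : L.Formula (α ⊕ γ) :=
    (χ.relabel (Sum.elim (Sum.inl ∘ Sum.inl) Sum.inr) ⊓ eqs : L.Formula ((α ⊕ γ) ⊕ β)).iExs β
  have hχ' : ∀ c, χ'.Realize (Sum.elim a c) ↔ ∃ y, χ.Realize (Sum.elim a y) ∧ c = y ∘ g := by
    intro c
    simp only [χ', eqs, Formula.realize_iExs, Formula.realize_inf, Formula.realize_relabel,
      Formula.realize_iInf, Formula.realize_equal, Sum.comp_elim, funext_iff, ← Function.comp_assoc,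
      Sum.elim_comp_inl, Sum.elim_comp_inr]
    simp
  refine ⟨χ', (hχ' _).2 ⟨b, hχ.1, rfl⟩, fun ψ hψ c hc => ?_⟩
  obtain ⟨y, hy, rfl⟩ := (hχ' _).1 hc
  have h := hχ.2 (ψ.relabel (Sum.map id g))
  simp only [Formula.realize_relabel, Sum.elim_comp_map, Function.comp_id] at h
  exact h hψ y hy

theorem TypeIsolated.of_assoc {a : α → M} {b : β → M} {c : γ → M}
    (h : TypeIsolated L a (Sum.elim b c)) : TypeIsolated L (Sum.elim a b) c := by
  obtain ⟨χ, hχ⟩ := h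
  have hσ : ∀ c : γ → M, Sum.elim (Sum.elim a b) c ∘ (Equiv.sumAssoc α β γ).symm =
      Sum.elim a (Sum.elim b c) := by
    intro c; funext i; rcases i with i | i | i <;> rfl
  have hσ' : ∀ c : γ → M, Sum.elim a (Sum.elim b c) ∘ Equiv.sumAssoc α β γ =
      Sum.elim (Sum.elim a b) c := by
    intro c; funext i; rcases i with (i | i) | i <;> rfl
  refine ⟨χ.relabel (Equiv.sumAssoc α β γ).symm, ?_, fun ψ hψ c' hc' => ?_⟩
  · rw [Formula.realize_relabel, hσ]; exact hχ.1
  · have := hχ.2 (ψ.relabel (Equiv.sumAssoc α β γ))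
    simp only [Formula.realize_relabel] at this hc'
    rw [hσ] at hc'
    have := this (by rwa [hσ']) _ hc'
    rwa [hσ'] at this

/-- Isolation is transitive when the parameters are kept: if `tp(b/a)` and `tp(c/ab)` are isolated
then so is `tp(bc/a)`. -/
theorem TypeIsolated.assoc [Finite β] [Finite γ] {a : α → M} {b : β → M} {c : γ → M}
    (hb : TypeIsolated L a b) (hc : TypeIsolated L (Sum.elim a b) c) :
    TypeIsolated L a (Sum.elim b c) := by
  obtain ⟨φ, hφ⟩ := hb
  obtain ⟨χ, hχ⟩ := hc
  have h₁ : ∀ y : β ⊕ γ → M, Sum.elim a y ∘ Sum.map id Sum.inl = Sum.elim a (y ∘ Sum.inl) := by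
    intro y; funext i; rcases i with i | i <;> rfl
  have h₂ : ∀ y : β ⊕ γ → M, Sum.elim a y ∘ Equiv.sumAssoc α β γ =
      Sum.elim (Sum.elim a (y ∘ Sum.inl)) (y ∘ Sum.inr) := by
    intro y; funext i; rcases i with (i | i) | i <;> rfl
  have h₃ : ∀ y : β ⊕ γ → M, Sum.elim (Sum.elim a (y ∘ Sum.inl)) (y ∘ Sum.inr) ∘
      (Equiv.sumAssoc α β γ).symm = Sum.elim a y := by
    intro y; funext i; rcases i with i | i | i <;> rfl
  refine ⟨φ.relabel (Sum.map id Sum.inl) ⊓ χ.relabel (Equiv.sumAssoc α β γ), ?_, ?_⟩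
  · simp only [Formula.realize_inf, Formula.realize_relabel, h₁, h₂]
    exact ⟨hφ.1, hχ.1⟩
  · intro ψ hψ y hy
    simp only [Formula.realize_inf, Formula.realize_relabel, h₁, h₂] at hy
    have := (hχ.sameType (hφ.sameType (fun _ => Iff.rfl) hy.1) hy.2).comp
      (Equiv.sumAssoc α β γ).symm
    have h₄ := h₃ (Sum.elim b c)
    simp only [Sum.elim_comp_inl, Sum.elim_comp_inr] at h₄
    rw [h₃, h₄] at this
    exact (this ψ).1 hψ

/-- If `c` is isolated over `a` and the pair `ad` is isolated over `c`, then `d` is isolated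
over `a`: take the formula `∃ z (χ(a, z) ∧ φ(z, a, y))`, where `χ(a, z)` isolates `tp(c/a)` and
`φ(c, x, y)` isolates `tp(ad/c)`. This is what moves atomicity from one base to another. -/
theorem TypeIsolated.change_base [Finite α] [Finite β] [Finite γ] {a : α → M} {c : γ → M}
    {d : β → M} (hc : TypeIsolated L a c) (hd : TypeIsolated L c (Sum.elim a d)) :
    TypeIsolated L a d := by
  obtain ⟨χ, hχ⟩ := hc
  obtain ⟨φ, hφ⟩ := hd
  let σ : γ ⊕ (α ⊕ β) → (α ⊕ β) ⊕ γ := Sum.elim Sum.inr Sum.inl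
  let ζ : L.Formula (α ⊕ β) :=
    (χ.relabel (Sum.map Sum.inl id) ⊓ φ.relabel σ : L.Formula ((α ⊕ β) ⊕ γ)).iExs γ
  have hζ : ∀ y, ζ.Realize (Sum.elim a y) ↔
      ∃ z, χ.Realize (Sum.elim a z) ∧ φ.Realize (Sum.elim z (Sum.elim a y)) := by
    intro y
    simp only [ζ, σ, Formula.realize_iExs, Formula.realize_inf, Formula.realize_relabel,
      Sum.comp_elim, Sum.elim_comp_inl, Sum.elim_comp_inr, Sum.elim_comp_map, Function.comp_id]
  refine ⟨ζ, (hζ d).2 ⟨c, hχ.1, hφ.1⟩, fun ψ hψ y hy => ?_⟩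
  obtain ⟨z, hz, hzy⟩ := (hζ y).1 hy
  have hcz : SameType L c z := (hχ.sameType (fun _ => Iff.rfl) hz).inr
  have := (hφ.sameType hcz hzy).inr
  exact (this ψ).1 hψ

theorem isolates_iff {m n : ℕ} {a : Fin m → M} {b : Fin n → M} :
    Isolates L a b ↔ TypeIsolated L a b := by
  constructor
  · rintro ⟨φ, hφ, hb, -⟩
    refine ⟨φ, hb, fun ψ hψ => ?_⟩
    exact (hφ.2 ψ).resolve_right fun h => h b hb hψ
  · rintro ⟨χ, hχ⟩
    refine ⟨χ, ⟨⟨b, hχ.1⟩, fun ψ => ?_⟩, hχ.1, fun ψ hψ c hc => ?_⟩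
    · by_cases h : Holds ψ a b
      · exact Or.inl (hχ.2 ψ h)
      · exact Or.inr (hχ.2 ψ.not h)
    · exact ((hχ.sameType (fun _ => Iff.rfl) hc).inr ψ).1 hψ

theorem IsPrincipal.isolatesBy {m n : ℕ} {φ : L.Formula (Fin m ⊕ Fin n)} {a : Fin m → M}
    {b : Fin n → M} (h : IsPrincipal φ a) (hb : Holds φ a b) : IsolatesBy φ a b :=
  ⟨hb, fun ψ hψ => (h.2 ψ).resolve_right fun h' => h' b hb hψ⟩

theorem IsolatesBy.isPrincipal {m n : ℕ} {φ : L.Formula (Fin m ⊕ Fin n)} {a : Fin m → M}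
    {b : Fin n → M} (h : IsolatesBy φ a b) : IsPrincipal φ a := by
  refine ⟨⟨b, h.1⟩, fun ψ => ?_⟩
  by_cases hψ : Holds ψ a b
  · exact Or.inl (h.2 ψ hψ)
  · exact Or.inr (h.2 ψ.not hψ)

theorem IsAtomicOver.typeIsolated [Finite β] {a : α → M} (h : IsAtomicOver L a) (d : β → M) :
    TypeIsolated L a d := by
  obtain ⟨k, ⟨e⟩⟩ := Finite.exists_equiv_fin β
  simpa [Function.comp_assoc] using (h k (d ∘ e.symm)).comp e

/-- Atomicity over `c` passes to any tuple `a` over which `c` is isolated. -/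
theorem IsAtomicOver.change_base [Finite α] [Finite γ] {c : γ → M} (h : IsAtomicOver L c)
    {a : α → M} (hc : TypeIsolated L a c) : IsAtomicOver L a :=
  fun _ d => hc.change_base (h.typeIsolated (Sum.elim a d))

end TypeIsolation

/-! ### Isolated types are dense in small theories -/

section Density

variable {L : FirstOrder.Language.{u, v}} {T : L.Theory}

theorem IsSmall.countable_completeType (hT : IsSmall T) (α : Type) [Finite α] :
    Countable (T.CompleteType α) := by
  obtain ⟨k, ⟨e⟩⟩ := Finite.exists_equiv_fin α
  have := hT k
  choose N v hv using fun q : T.CompleteType α => T.exists_modelType_is_realized_in q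
  refine Function.Injective.countable (f := fun q => T.typeOf (v q ∘ e.symm)) fun q q' h => ?_
  rw [← hv q, ← hv q', typeOf_eq_iff]
  simpa [Function.comp_assoc] using (typeOf_eq_iff.1 h).comp e

variable {M : Type w} [L.Structure M] [Nonempty M] [M ⊨ T] {α β : Type} [Finite α] [Finite β]

/-- In a small theory every formula that is consistent over a finite tuple is satisfied by a tuple
whose type is isolated. The types over `a` containing the formula form a countable nonempty compact
Hausdorff space, which has an isolated point by the Baire category theorem. -/
theorem IsSmall.exists_isolatesBy (hT : IsSmall T) (a : α → M) {φ : L.Formula (α ⊕ β)} {b : β → M}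
    (hφ : φ.Realize (Sum.elim a b)) :
    ∃ (χ : L.Formula (α ⊕ β)) (c : β → M), φ.Realize (Sum.elim a c) ∧ IsolatesBy χ a c := by
  have := hT.countable_completeType (α ⊕ β)
  let K : Set (T.CompleteType (α ⊕ β)) :=
    (⋂ ψ : {ψ : L.Formula α // ψ.Realize a},
      T.typesWith (Formula.equivSentence (ψ.1.relabel Sum.inl : L.Formula (α ⊕ β)))) ∩
      T.typesWith (Formula.equivSentence φ)
  have hK : IsClosed K :=
    (isClosed_iInter fun _ => CompleteType.isClosed_typesWith _).inter
      (CompleteType.isClosed_typesWith _)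
  have hmem : ∀ c, φ.Realize (Sum.elim a c) → T.typeOf (Sum.elim a c) ∈ K := by
    intro c hc
    refine ⟨Set.mem_iInter.2 fun ψ => ?_, Theory.CompleteType.formula_mem_typeOf.2 hc⟩
    refine Theory.CompleteType.formula_mem_typeOf.2 ?_
    rw [Formula.realize_relabel]
    exact ψ.2
  have : CompactSpace K := isCompact_iff_compactSpace.1 hK.isCompact
  have : Nonempty K := ⟨⟨_, hmem b hφ⟩⟩
  have : BaireSpace K := BaireSpace.of_t2Space_locallyCompactSpace
  obtain ⟨q, hq⟩ := nonempty_interior_of_iUnion_of_closed (X := K) (f := fun q : K => {q})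
    (fun _ => isClosed_singleton) (by ext; simp)
  obtain ⟨r, hr⟩ := hq
  obtain rfl : r = q := Set.mem_singleton_iff.1 (interior_subset hr)
  obtain ⟨O, hO, hOq⟩ := isOpen_induced_iff.1 (isOpen_interior (s := ({r} : Set K)))
  have hrO : r.1 ∈ O := by
    have : r ∈ Subtype.val ⁻¹' O := hOq ▸ hr
    exact this
  obtain ⟨_, ⟨χ, rfl⟩, hrχ, hχO⟩ :=
    CompleteType.isTopologicalBasis_range_typesWith.exists_subset_of_mem_open hrO hO
  obtain ⟨χ, rfl⟩ := Formula.equivSentence.surjective χ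
  have huniq : ∀ c, (χ ⊓ φ).Realize (Sum.elim a c) → T.typeOf (Sum.elim a c) = r.1 := by
    intro c hc
    have hc := Formula.realize_inf.1 hc
    have h₁ : (⟨_, hmem c hc.2⟩ : K) ∈ Subtype.val ⁻¹' O :=
      hχO (Theory.CompleteType.formula_mem_typeOf.2 hc.1)
    rw [hOq] at h₁
    exact congrArg Subtype.val (Set.mem_singleton_iff.1 (interior_subset h₁))
  -- The isolated point `r` is realized in `M`: otherwise `a` satisfies `¬ ∃ y (χ ∧ φ)`, and so
  -- does the first part of any realization of `r`.
  obtain ⟨c, hc⟩ : ∃ c, (χ ⊓ φ).Realize (Sum.elim a c) := by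
    obtain ⟨N, x, hx⟩ := T.exists_modelType_is_realized_in r.1
    have hrK := r.2
    rw [← hx] at hrK hrχ
    have hax : SameType L a (x ∘ Sum.inl) := by
      have key : ∀ ψ : L.Formula α, ψ.Realize a → ψ.Realize (x ∘ Sum.inl) := by
        intro ψ hψ
        have := Theory.CompleteType.formula_mem_typeOf.1 (Set.mem_iInter.1 hrK.1 ⟨ψ, hψ⟩)
        rwa [Formula.realize_relabel] at this
      refine fun ψ => ⟨key ψ, fun hψ => ?_⟩
      by_contra hn
      exact key ψ.not hn hψ
    refine (hax.exists_iff (χ ⊓ φ)).2 ⟨x ∘ Sum.inr, ?_⟩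
    rw [Sum.elim_comp_inl_inr]
    exact Formula.realize_inf.2 ⟨Theory.CompleteType.formula_mem_typeOf.1 hrχ,
      Theory.CompleteType.formula_mem_typeOf.1 hrK.2⟩
  refine ⟨χ ⊓ φ, c, (Formula.realize_inf.1 hc).2, hc, fun ψ hψ d hd => ?_⟩
  exact (typeOf_eq_iff.1 ((huniq c hc).trans (huniq d hd).symm) ψ).1 hψ

end Density

/-! ### Countable atomic models -/

section Atomic

/-- The sequence whose `k`-th term is computed by `F` from the terms before it. -/
def seqOfInitial {N : Type*} (F : ∀ k, (Fin k → N) → N) : ℕ → N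
  | k => F k fun i => seqOfInitial F i

theorem exists_seq_of_initial {N : Type*} {P : ∀ k, (Fin k → N) → N → Prop}
    (h : ∀ k w, ∃ y, P k w y) : ∃ g : ℕ → N, ∀ k, P k (fun i : Fin k => g i) (g k) := by
  choose F hF using h
  refine ⟨seqOfInitial F, fun k => ?_⟩
  rw [seqOfInitial.eq_def F k]
  exact hF k _

variable {L : FirstOrder.Language.{u, v}} {α : Type}

/-- Reindexing of tuples that turns a tuple followed by one more element into a longer tuple. -/
def snocIndex (α : Type) (k : ℕ) : α ⊕ Fin (k + 1) → (α ⊕ Fin k) ⊕ Unit :=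
  Sum.elim (Sum.inl ∘ Sum.inl) (Fin.lastCases (Sum.inr ()) (Sum.inl ∘ Sum.inr))

theorem comp_snocIndex {M : Type*} (a : α → M) (e : ℕ → M) (k : ℕ) :
    Sum.elim (Sum.elim a fun i : Fin k => e i) (fun _ => e k) ∘ snocIndex α k =
      Sum.elim a fun i : Fin (k + 1) => e i := by
  funext i
  rcases i with i | i
  · rfl
  · refine Fin.lastCases ?_ (fun i => ?_) i <;> simp [snocIndex]

theorem exists_sameType_seq {M N : Type*} [L.Structure M] [L.Structure N] [Nonempty M]
    {a : α → M} {d : α → N} (had : SameType L a d) {e : ℕ → M}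
    (he : ∀ k, TypeIsolated L (Sum.elim a fun i : Fin k => e i) (fun _ : Unit => e k)) :
    ∃ g : ℕ → N, ∀ k,
      SameType L (Sum.elim a fun i : Fin k => e i) (Sum.elim d fun i : Fin k => g i) := by
  have : Nonempty N := by
    obtain ⟨y, -⟩ := (had.exists_iff (⊤ : L.Formula (α ⊕ Unit))).1
      ⟨fun _ => Classical.arbitrary M, Formula.realize_top.2 trivial⟩
    exact ⟨y ()⟩
  obtain ⟨g, hg⟩ := exists_seq_of_initial (N := N)
    (P := fun k w y => SameType L (Sum.elim a fun i : Fin k => e i) (Sum.elim d w) →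
      SameType L (Sum.elim (Sum.elim a fun i : Fin k => e i) (fun _ : Unit => e k))
        (Sum.elim (Sum.elim d w) (fun _ : Unit => y))) (by
      intro k w
      by_cases h : SameType L (Sum.elim a fun i : Fin k => e i) (Sum.elim d w)
      · obtain ⟨χ, hχ⟩ := he k
        obtain ⟨y, hy⟩ := (h.exists_iff χ).1 ⟨_, hχ.1⟩
        exact ⟨y (), fun _ => hχ.sameType h hy⟩
      · exact ⟨Classical.arbitrary N, fun h' => absurd h' h⟩)
  refine ⟨g, fun k => ?_⟩
  induction k with
  | zero =>
    have h := had.comp (Sum.elim id Fin.elim0 : α ⊕ Fin 0 → α)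
    have hx : ∀ {P : Type _} (x : α → P) (y : Fin 0 → P),
        x ∘ (Sum.elim id Fin.elim0 : α ⊕ Fin 0 → α) = Sum.elim x y := by
      intro P x y; funext i; rcases i with i | i
      · rfl
      · exact i.elim0
    rw [hx a fun i : Fin 0 => e i] at h
    convert h using 1
    funext i; rcases i with i | i
    · rfl
    · exact i.elim0
  | succ k ih =>
    have := (hg k ih).comp (snocIndex α k)
    rwa [comp_snocIndex, comp_snocIndex] at this

/-- A countable model that is atomic over a finite tuple is prime over it. -/
theorem IsAtomicOver.isPrimeOver {M : Type w} [L.Structure M] [Countable M] [Nonempty M] {n : ℕ}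
    {a : Fin n → M} (h : IsAtomicOver L a) : IsPrimeOver L a := by
  intro N _ d had
  obtain ⟨e, he⟩ := exists_surjective_nat M
  obtain ⟨g, hg⟩ := exists_sameType_seq (e := e) had fun k =>
    (h.typeIsolated (Sum.elim (fun i : Fin k => e i) fun _ : Unit => e k)).of_assoc
  choose s hs using he
  have key : ∀ {m : ℕ} (x : Fin m → M), SameType L (Sum.elim a x) (Sum.elim d (g ∘ s ∘ x)) := by
    intro m x
    obtain ⟨k, hk⟩ := (Set.finite_range (s ∘ x)).bddAbove
    have := (hg (k + 1)).comp
      (Sum.map id fun i : Fin m => ⟨s (x i), Nat.lt_succ_of_le (hk ⟨i, rfl⟩)⟩)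
    simp only [Sum.elim_comp_map, Function.comp_id] at this
    simpa only [Function.comp_def, hs] using this
  refine ⟨⟨g ∘ s, fun m φ x => ((key x).inr φ).symm⟩, fun i => ?_⟩
  have := key (fun _ : Fin 1 => a i)
    ((Term.var (Sum.inl i) : L.Term (Fin n ⊕ Fin 1)).equal (Term.var (Sum.inr 0)))
  simp only [Formula.realize_equal, Term.realize_var, Sum.elim_inl, Sum.elim_inr,
    Function.comp_apply, true_iff] at this
  exact this.symm

theorem typeIsolated_initial {M : Type*} [L.Structure M] {a : α → M} {e : ℕ → M}
    (he : ∀ k, TypeIsolated L (Sum.elim a fun i : Fin k => e i) (fun _ : Unit => e k)) (k : ℕ) :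
    TypeIsolated L a fun i : Fin k => e i := by
  induction k with
  | zero =>
    refine ⟨⊤, Formula.realize_top.2 trivial, fun ψ hψ c _ => ?_⟩
    rwa [Subsingleton.elim c fun i : Fin 0 => e i]
  | succ k ih =>
    have := (ih.assoc (he k)).comp
      (Fin.lastCases (Sum.inr ()) Sum.inl : Fin (k + 1) → Fin k ⊕ Unit)
    convert this using 1
    funext i
    refine Fin.lastCases ?_ (fun i => ?_) i <;> simp

variable {T : L.Theory} {M : Type w} [L.Structure M] [Nonempty M] [M ⊨ T] [Finite α]

/-- A model of a small theory contains a sequence, each term of which is isolated over `a` and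
the terms before it, that meets every nonempty set definable over `a` and finitely many of its
terms. It is built by running through the countably many types that an element can have over an
initial segment. -/
theorem IsSmall.exists_constructible_seq (hT : IsSmall T) (a : α → M) :
    ∃ e : ℕ → M,
      (∀ k, TypeIsolated L (Sum.elim a fun i : Fin k => e i) (fun _ : Unit => e k)) ∧
      ∀ (j : ℕ) (φ : L.Formula ((α ⊕ Fin j) ⊕ Unit)) (x : M),
        φ.Realize (Sum.elim (Sum.elim a fun i : Fin j => e i) fun _ => x) →
          ∃ k, φ.Realize (Sum.elim (Sum.elim a fun i : Fin j => e i) fun _ => e k) := by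
  have := fun j : ℕ => hT.countable_completeType ((α ⊕ Fin j) ⊕ Unit)
  have : Nonempty (Σ j : ℕ, T.CompleteType ((α ⊕ Fin j) ⊕ Unit)) :=
    ⟨⟨0, T.typeOf fun _ => Classical.arbitrary M⟩⟩
  obtain ⟨s, hs⟩ := exists_surjective_nat (Σ j : ℕ, T.CompleteType ((α ⊕ Fin j) ⊕ Unit))
  -- Step `k` handles the request `s k.unpair.1`, so that every request is met at arbitrarily late
  -- steps, in particular at one where the initial segment it speaks about has been built.
  obtain ⟨e, he⟩ := exists_seq_of_initial (N := M)
    (P := fun k w y => TypeIsolated L (Sum.elim a w) (fun _ : Unit => y) ∧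
      ∀ hj : (s k.unpair.1).1 ≤ k,
        (∃ y', TypeIsolated L (Sum.elim a w) (fun _ : Unit => y') ∧
          T.typeOf (Sum.elim (Sum.elim a (w ∘ Fin.castLE hj)) fun _ : Unit => y') =
            (s k.unpair.1).2) →
        T.typeOf (Sum.elim (Sum.elim a (w ∘ Fin.castLE hj)) fun _ : Unit => y) =
            (s k.unpair.1).2) (by
      intro k w
      by_cases h : ∃ hj : (s k.unpair.1).1 ≤ k,
        (∃ y', TypeIsolated L (Sum.elim a w) (fun _ : Unit => y') ∧
          T.typeOf (Sum.elim (Sum.elim a (w ∘ Fin.castLE hj)) fun _ : Unit => y') =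
            (s k.unpair.1).2)
      · obtain ⟨hj, y, hy, hq⟩ := h
        exact ⟨y, hy, fun _ _ => hq⟩
      · obtain ⟨χ, c, -, hc⟩ := hT.exists_isolatesBy (Sum.elim a w)
          (φ := (⊤ : L.Formula ((α ⊕ Fin k) ⊕ Unit))) (b := fun _ => Classical.arbitrary M)
          (Formula.realize_top.2 trivial)
        exact ⟨c (), ⟨χ, hc⟩, fun hj h' => absurd ⟨hj, h'⟩ h⟩)
  refine ⟨e, fun k => (he k).1, fun j φ x hx => ?_⟩
  obtain ⟨χ, c, hφc, hc⟩ := hT.exists_isolatesBy (Sum.elim a fun i : Fin j => e i) hx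
  obtain ⟨m, hm⟩ := hs ⟨j, T.typeOf (Sum.elim (Sum.elim a fun i : Fin j => e i) c)⟩
  have hk := (he (Nat.pair m j)).2
  rw [Nat.unpair_pair, hm] at hk
  have hj := Nat.right_le_pair m j
  obtain ⟨χ', c', hχc', hc'⟩ := hT.exists_isolatesBy
    (Sum.elim a fun i : Fin (Nat.pair m j) => e i) (b := c)
    (φ := χ.relabel (Sum.map (Sum.map id (Fin.castLE hj)) id)) (by
      simp only [Formula.realize_relabel, Sum.elim_comp_map, Function.comp_id]
      exact hc.1)
  simp only [Formula.realize_relabel, Sum.elim_comp_map, Function.comp_id] at hχc'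
  have hek := hk hj ⟨c' (), ⟨χ', hc'⟩,
    typeOf_eq_iff.2 (hc.sameType (fun _ => Iff.rfl) hχc').symm⟩
  exact ⟨_, (typeOf_eq_iff.1 hek φ).2 hφc⟩

/-- In a small theory, a countable atomic elementary substructure exists over every finite tuple
of every model. -/
theorem IsSmall.exists_countable_atomic (hT : IsSmall T) (a : α → M) :
    ∃ S : L.ElementarySubstructure M, Countable S ∧ (∀ i, a i ∈ S) ∧
      ∀ (k : ℕ) (d : Fin k → M), (∀ i, d i ∈ S) → TypeIsolated L a d := by
  obtain ⟨e, he, hmeet⟩ := hT.exists_constructible_seq a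
  have hdef : L.MeetsDefinable (Set.range e) := by
    rintro D ⟨x, hx⟩ hD
    obtain ⟨A, hA, hAD⟩ := Set.definable_iff_finitely_definable.1 hD
    obtain ⟨φ, hφ⟩ := Set.definable_iff_exists_formula_sum.1 hAD
    have hφ : ∀ x, x ∈ D ↔ φ.Realize (Sum.elim Subtype.val fun _ => x) := fun x =>
      Set.ext_iff.1 hφ fun _ => x
    choose s hs using fun y : (A : Set M) => hA y.2
    obtain ⟨j, hj⟩ := (Set.finite_range s).bddAbove
    let σ : (A : Set M) ⊕ Fin 1 → (α ⊕ Fin (j + 1)) ⊕ Unit :=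
      Sum.map (fun y => Sum.inr ⟨s y, Nat.lt_succ_of_le (hj ⟨y, rfl⟩)⟩) fun _ => ()
    have hσ : ∀ y : M, (φ.relabel σ).Realize
        (Sum.elim (Sum.elim a fun i : Fin (j + 1) => e i) fun _ => y) ↔
          φ.Realize (Sum.elim Subtype.val fun _ => y) := by
      intro y
      simp only [σ, Formula.realize_relabel, Sum.elim_comp_map]
      simp only [Function.comp_def, Sum.elim_inr, hs]
    obtain ⟨k, hk⟩ := hmeet (j + 1) (φ.relabel σ) x ((hσ x).2 ((hφ x).1 hx))
    exact ⟨e k, (hφ _).2 ((hσ _).1 hk), k, rfl⟩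
  have hmem : ∀ x, x ∈ hdef.toElementarySubstructure ↔ x ∈ Set.range e := fun x =>
    Set.ext_iff.1 hdef.closure_eq_self x
  refine ⟨hdef.toElementarySubstructure, ?_, fun i => ?_, fun k d hd => ?_⟩
  · have : Countable (Set.range e) := (Set.countable_range e).to_subtype
    exact Function.Injective.countable
      (f := fun x : hdef.toElementarySubstructure => (⟨x.1, (hmem x.1).1 x.2⟩ : Set.range e))
      fun x y h => Subtype.ext (congrArg (fun z : Set.range e => z.1) h)
  · obtain ⟨k, hk⟩ := hmeet 0
      ((Term.var (Sum.inl (Sum.inl i)) : L.Term ((α ⊕ Fin 0) ⊕ Unit)).equal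
        (Term.var (Sum.inr ()))) (a i) (by simp)
    refine (hmem _).2 ⟨k, ?_⟩
    simpa using hk.symm
  · choose s hs using fun i => (hmem _).1 (hd i)
    obtain ⟨j, hj⟩ := (Set.finite_range s).bddAbove
    have := (typeIsolated_initial he (j + 1)).comp
      fun i : Fin k => ⟨s i, Nat.lt_succ_of_le (hj ⟨i, rfl⟩)⟩
    simpa only [Function.comp_def, hs] using this

/-- A model of a small theory that is prime over a finite tuple is atomic over it, as it embeds
into an atomic model. -/
theorem IsPrimeOver.isAtomicOver (hT : IsSmall T) {n : ℕ} {c : Fin n → M}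
    (h : IsPrimeOver L c) : IsAtomicOver L c := by
  obtain ⟨S, -, hcS, hS⟩ := hT.exists_countable_atomic c
  obtain ⟨f, hf⟩ := h S (fun i => ⟨c i, hcS i⟩) fun φ =>
    S.subtype.map_formula φ fun i => ⟨c i, hcS i⟩
  intro k d
  rw [← typeIsolated_map_iff (S.subtype.comp f)]
  have hfc : S.subtype.comp f ∘ c = c := by funext i; simp [hf]
  rw [hfc]
  exact hS k _ fun i => (f (d i)).2

end Atomic

/-! ### Limits of elementary chains -/

section Limit

variable {L : FirstOrder.Language.{u, v}}

/-- The maps into the direct limit of a directed system of elementary embeddings preserve the truth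
of all formulas. -/
theorem realize_directLimit_of {ι : Type*} [Preorder ι] [IsDirectedOrder ι] [Nonempty ι]
    {G : ι → Type w} [∀ i, L.Structure (G i)] (f : ∀ i j, i ≤ j → G i ↪[L] G j)
    [DirectedSystem G fun i j h => f i j h]
    (hf : ∀ i j h, ∃ g : G i ↪ₑ[L] G j, ∀ x, g x = f i j h x)
    {n : ℕ} (φ : L.BoundedFormula Empty n) (i : ι) (xs : Fin n → G i) :
    φ.Realize default (Language.DirectLimit.of L ι G f i ∘ xs) ↔ φ.Realize default xs := by
  have hd : ∀ i, (default : Empty → Language.DirectLimit G f) =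
      Language.DirectLimit.of L ι G f i ∘ default :=
    fun i => Subsingleton.elim _ _
  induction φ generalizing i with
  | falsum => exact Iff.rfl
  | equal t₁ t₂ =>
    rw [hd i]
    simp only [BoundedFormula.Realize, ← Sum.comp_elim, HomClass.realize_term,
      (Language.DirectLimit.of L ι G f i).injective.eq_iff]
  | rel R ts =>
    rw [hd i]
    simp only [BoundedFormula.Realize, ← Sum.comp_elim, HomClass.realize_term]
    exact (Language.DirectLimit.of L ι G f i).map_rel R _
  | imp φ ψ ih₁ ih₂ => simp only [BoundedFormula.realize_imp, ih₁, ih₂]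
  | @all n φ ih =>
    simp only [BoundedFormula.realize_all]
    refine ⟨fun h x => ?_, fun h z => ?_⟩
    · refine (ih i _).1 ?_
      rw [Fin.comp_snoc]
      exact h _
    · obtain ⟨j, y, rfl⟩ := Language.DirectLimit.exists_of z
      obtain ⟨k, hik, hjk⟩ := exists_ge_ge i j
      obtain ⟨g, hg⟩ := hf i k hik
      have hall : φ.all.Realize default (g ∘ xs) := by
        rw [Subsingleton.elim (default : Empty → G k) (g ∘ default), g.map_boundedFormula]
        exact h
      have := (ih k _).2 (hall (f j k hjk y))
      rw [Fin.comp_snoc, Language.DirectLimit.of_f] at this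
      convert this using 2
      funext m
      rw [Function.comp_apply, Function.comp_apply, Function.comp_apply, hg,
        Language.DirectLimit.of_f]

/-- The limit of the chain `N → N → N → ⋯` in which every map is the elementary embedding `f`;
`h k` is the map of the `k`-th copy of `N` into it. -/
theorem exists_limit_of_selfEmbedding {N : Type w} [L.Structure N] [Countable N]
    (f : N ↪ₑ[L] N) :
    ∃ (M : Type w) (_ : L.Structure M) (h : ℕ → (N ↪ₑ[L] M)), Countable M ∧
      (∀ k x, h (k + 1) (f x) = h k x) ∧ ∀ y, ∃ k x, h k x = y := by
  let F := DirectedSystem.natLERec (L := L) (G' := fun _ : ℕ => N) fun _ => f.toEmbedding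
  have hF : ∀ i j h, ∃ g : N ↪ₑ[L] N, ∀ x, g x = F i j h x := by
    intro i j h
    induction j, h using Nat.le_induction with
    | base =>
      exact ⟨ElementaryEmbedding.refl L N, fun x =>
        (DirectedSystem.map_self' (f := fun i j h => F i j h) x).symm⟩
    | succ j h ih =>
      obtain ⟨g, hg⟩ := ih
      refine ⟨f.comp g, fun x => ?_⟩
      simp only [F] at hg
      simp only [F, ElementaryEmbedding.comp_apply, hg, DirectedSystem.coe_natLERec,
        Nat.leRecOn_succ h]
      rfl
  refine ⟨Language.DirectLimit (fun _ : ℕ => N) F, inferInstance, fun k =>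
    ⟨Language.DirectLimit.of L ℕ (fun _ => N) F k, fun n φ x => ?_⟩, ?_, fun k x => ?_, fun y => ?_⟩
  · exact φ.realize_relabel_sumInr.symm.trans
      ((realize_directLimit_of F hF _ k x).trans φ.realize_relabel_sumInr)
  · have : Function.Surjective fun q : ℕ × N =>
        Language.DirectLimit.of L ℕ (fun _ => N) F q.1 q.2 :=
      fun y => let ⟨k, x, h⟩ := Language.DirectLimit.exists_of y; ⟨(k, x), h⟩
    exact this.countable
  · have hk : F k (k + 1) k.le_succ x = f x := by
      simp only [F, DirectedSystem.coe_natLERec]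
      exact Nat.leRecOn_succ' (C := fun _ => N) x
    rw [← hk]
    exact Language.DirectLimit.of_f (G := fun _ : ℕ => N) (f := F) (hij := k.le_succ) (x := x)
  · exact Language.DirectLimit.exists_of y

/-- The range of an elementary embedding is an elementary substructure. -/
def elementaryRange {N : Type*} {M : Type*} [L.Structure N] [L.Structure M] (g : N ↪ₑ[L] M) :
    L.ElementarySubstructure M where
  toSubstructure := g.toHom.range
  isElementary' := by
    intro n φ x
    choose y hy using fun i => (x i).2
    have h₁ : (Subtype.val ∘ x : Fin n → M) = g ∘ y := funext fun i => (hy i).symm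
    have h₂ : x = g.toEmbedding.equivRange.toElementaryEmbedding ∘ y :=
      funext fun i => Subtype.ext (hy i).symm
    rw [h₁, g.map_formula]
    conv_rhs => rw [h₂]
    exact (g.toEmbedding.equivRange.toElementaryEmbedding.map_formula φ y).symm

theorem mem_elementaryRange {N : Type*} {M : Type*} [L.Structure N] [L.Structure M]
    {g : N ↪ₑ[L] M} {y : M} : y ∈ elementaryRange g ↔ ∃ x, g x = y := Iff.rfl

/-- If a model is atomic over `a`, then its image under an elementary embedding is atomic over the
image of `a`. -/
theorem IsAtomicOver.elementaryRange {N : Type*} {M : Type*} [L.Structure N] [L.Structure M]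
    {α : Type} {a : α → N} (h : IsAtomicOver L a) (g : N ↪ₑ[L] M) :
    IsAtomicOver L (fun i => (⟨g (a i), a i, rfl⟩ : elementaryRange g)) := by
  intro k d
  choose y hy using fun i => (d i).2
  rw [← typeIsolated_map_iff (IsolatingFormulas.elementaryRange g).subtype]
  have h₂ : (IsolatingFormulas.elementaryRange g).subtype ∘ d = g ∘ y :=
    funext fun i => (hy i).symm
  rw [h₂]
  exact (typeIsolated_map_iff g).2 (h k y)

/-- If a countable model `N`, atomic over a realization `a` of `p`, has an elementary self-embedding
`f` such that `f(a)` does not isolate `a`, then the limit of the chain of copies of `N` along `f` is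
a limit model over `p`. If it were prime over a tuple `c`, which lies in the `k`-th copy of `N`,
then it would be atomic over the `k`-th copy of `a`, which would therefore isolate the next one. -/
theorem exists_isLimitOver {T : L.Theory} (hT : IsSmall T) {n : ℕ} {p : T.CompleteType (Fin n)}
    {N : Type (max u v)} [L.Structure N] [Countable N] [Nonempty N] [N ⊨ T] {a : Fin n → N}
    (hap : T.typeOf a = p) (ha : IsAtomicOver L a) {f : N ↪ₑ[L] N}
    (hf : ¬ TypeIsolated L (f ∘ a) a) :
    ∃ M : Theory.ModelType.{u, v, max u v} T, IsLimitOver p M := by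
  obtain ⟨M, _, h, hM, hsucc, hsurj⟩ := exists_limit_of_selfEmbedding f
  have : Nonempty M := ⟨h 0 (Classical.arbitrary N)⟩
  have : M ⊨ T := ((h 0).theory_model_iff T).1 inferInstance
  have hmono : Monotone fun k => elementaryRange (h k) := by
    refine monotone_nat_of_le_succ fun k => ?_
    rintro _ ⟨x, rfl⟩
    exact ⟨f x, hsucc k x⟩
  refine ⟨⟨M⟩, hM, fun m c hc => hf ?_, fun k => elementaryRange (h k), hmono, fun y => ?_,
    fun k => ⟨fun i => ⟨h k (a i), a i, rfl⟩, ?_, ?_⟩⟩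
  · have hc : IsAtomicOver L c := IsPrimeOver.isAtomicOver (T := T) (M := M) hT hc
    choose s x hx using fun i => hsurj (c i)
    obtain ⟨k, hk⟩ := (Set.finite_range s).bddAbove
    choose c' hc' using fun i => hmono (hk ⟨i, rfl⟩) (mem_elementaryRange.2 ⟨x i, hx i⟩)
    have h₁ : TypeIsolated L (h k ∘ a) c := by
      rw [show c = h k ∘ c' from funext fun i => (hc' i).symm, typeIsolated_map_iff]
      exact ha _ c'
    have h₂ := hc.change_base h₁ n (h (k + 1) ∘ a)
    rwa [show h k ∘ a = h (k + 1) ∘ (f ∘ a) from funext fun i => (hsucc k (a i)).symm,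
      typeIsolated_map_iff] at h₂
  · obtain ⟨k, x, hx⟩ := hsurj y
    exact ⟨k, x, hx⟩
  · rw [← hap]
    exact typeOf_eq_iff.2 (sameType_elementaryEmbedding (h k) a).symm
  · have : Countable (elementaryRange (h k)) := Subtype.countable
    exact (ha.elementaryRange (h k)).isPrimeOver

end Limit

/-! ### Labels and isolation -/

section Labels

variable {L : FirstOrder.Language.{u, v}} {T : L.Theory} {n : ℕ} {p : T.CompleteType (Fin n)}
  {M N : Theory.ModelType.{u, v, max u v} T}

theorem IsolatesBy.mem_PF {χ : L.Formula (Fin n ⊕ Fin n)} {a b : Fin n → M}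
    (h : IsolatesBy χ a b) (ha : T.typeOf a = p) (hb : T.typeOf b = p) : χ ∈ PF p := by
  intro N a' ha'
  have haa' : SameType L a a' := typeOf_eq_iff.1 (ha.trans ha'.symm)
  refine ⟨?_, fun c hc => ?_⟩
  · obtain ⟨b', hb'⟩ := (haa'.exists_iff χ).1 ⟨b, h.1⟩
    exact (h.transfer (h.sameType haa' hb')).isPrincipal
  · exact (typeOf_eq_iff.2 (h.sameType haa' hc).inr).symm.trans hb

theorem isolatesBy_of_mem_PF {φ : L.Formula (Fin n ⊕ Fin n)} (hφ : φ ∈ PF p) {a b : Fin n → M}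
    (ha : T.typeOf a = p) (h : Holds φ a b) : IsolatesBy φ a b :=
  (hφ M a ha).1.isolatesBy h

/-- All arcs of a formula in `PF(p)` have the same type. -/
theorem sameType_of_mem_PF {φ : L.Formula (Fin n ⊕ Fin n)} (hφ : φ ∈ PF p) {a b : Fin n → M}
    {a' b' : Fin n → N} (ha : T.typeOf a = p) (ha' : T.typeOf a' = p) (h : Holds φ a b)
    (h' : Holds φ a' b') : SameType L (Sum.elim a b) (Sum.elim a' b') :=
  (isolatesBy_of_mem_PF hφ ha h).sameType (typeOf_eq_iff.1 (ha.trans ha'.symm)) h'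

/-- Formulas of `PF(p)` with a common arc are `PE(p)`-equivalent. -/
theorem PE_of_holds {φ ψ : PF p} {a b : Fin n → M} (ha : T.typeOf a = p) (hφ : Holds φ.1 a b)
    (hψ : Holds ψ.1 a b) : Quotient.mk (PE p) φ = Quotient.mk (PE p) ψ :=
  Quotient.sound fun _ _ ha' _ =>
    ⟨fun h => (sameType_of_mem_PF φ.2 ha ha' hφ h ψ.1).1 hψ,
      fun h => (sameType_of_mem_PF ψ.2 ha ha' hψ h φ.1).1 hφ⟩

/-- A class containing an arc `(a, b)` such that `b` isolates `a` consists of principal edges: if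
`φ(x, y)` is in the class and `χ(y, x)` isolates `tp(a/b)`, then `φ(x, y) ∧ χ(y, x)` is equivalent
to `φ(x, y)` and principal in both directions. -/
theorem mk_mem_PFS {φ : PF p} {a b : Fin n → M} (ha : T.typeOf a = p) (h : Holds φ.1 a b)
    (hba : Isolates L b a) : Quotient.mk (PE p) φ ∈ PFS p := by
  obtain ⟨χ, hχ⟩ := isolates_iff.1 hba
  have hab : Holds (swap χ) a b := (holds_swap χ b a).2 hχ.1
  have hφ := isolatesBy_of_mem_PF φ.2 ha h
  have hφχ : IsolatesBy (φ.1 ⊓ swap χ) a b :=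
    ⟨Formula.realize_inf.2 ⟨h, hab⟩, fun ψ hψ c hc => hφ.2 ψ hψ c (Formula.realize_inf.1 hc).1⟩
  have hmem := hφχ.mem_PF ha ((φ.2 M a ha).2 b h)
  refine ⟨⟨_, hmem⟩, PE_of_holds ha hφχ.1 h, M, a, b, ha, hφχ.1, ?_⟩
  have : IsolatesBy (swap (φ.1 ⊓ swap χ)) b a := by
    refine ⟨(holds_swap _ _ _).2 hφχ.1, fun ψ hψ c hc => hχ.2 ψ hψ c ?_⟩
    exact (holds_swap χ b c).1 (Formula.realize_inf.1 ((holds_swap _ c b).1 hc)).2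
  exact this.isPrincipal

variable {U : Type w} {A : LabelAlphabet U} (ν : RegularLabelling p A)

namespace RegularLabelling

theorem theta_mem_PF (t : ν.rho) : ν.theta t ∈ PF p :=
  (Quotient.out (Classical.choose t.2)).2

theorem holds_theta_iff (φ : PF p) {a b : Fin n → M} (ha : T.typeOf a = p) :
    Holds (ν.theta ⟨ν.toFun (Quotient.mk (PE p) φ), _, rfl⟩) a b ↔ Holds φ.1 a b := by
  let t : ν.rho := ⟨ν.toFun (Quotient.mk (PE p) φ), _, rfl⟩
  have h : Classical.choose t.2 = Quotient.mk (PE p) φ := ν.injective (Classical.choose_spec t.2)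
  have h' : Quotient.mk (PE p) (Quotient.out (Classical.choose t.2)) = Quotient.mk (PE p) φ := by
    rw [Quotient.out_eq, h]
  exact Quotient.exact h' M a ha b

variable {ν} in
theorem typeOf_of_holds {t : ν.rho} {a b : Fin n → M} (ha : T.typeOf a = p)
    (h : Holds (ν.theta t) a b) : T.typeOf b = p :=
  (ν.theta_mem_PF t M a ha).2 b h

variable {ν} in
theorem typeIsolated_of_holds {t : ν.rho} {a b : Fin n → M} (ha : T.typeOf a = p)
    (h : Holds (ν.theta t) a b) : TypeIsolated L a b :=
  ⟨_, isolatesBy_of_mem_PF (ν.theta_mem_PF t) ha h⟩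

/-- Every pair of realizations of `p` whose first component isolates the second has a label. -/
theorem exists_holds_theta {a b : Fin n → M} (ha : T.typeOf a = p) (hb : T.typeOf b = p)
    (h : TypeIsolated L a b) : ∃ t, Holds (ν.theta t) a b := by
  obtain ⟨χ, hχ⟩ := h
  exact ⟨_, (ν.holds_theta_iff ⟨χ, hχ.mem_PF ha hb⟩ ha).2 hχ.1⟩

variable {ν} in
/-- The label of an arc is unique. -/
theorem eq_of_holds_theta {s t : ν.rho} {a b : Fin n → M} (ha : T.typeOf a = p)
    (hs : Holds (ν.theta s) a b) (ht : Holds (ν.theta t) a b) : s = t := by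
  obtain ⟨_, E, rfl⟩ := s
  obtain ⟨_, F, rfl⟩ := t
  induction E using Quotient.ind with | _ φ
  induction F using Quotient.ind with | _ ψ
  exact Subtype.ext (congrArg ν.toFun
    (PE_of_holds ha ((ν.holds_theta_iff φ ha).1 hs) ((ν.holds_theta_iff ψ ha).1 ht)))

variable {ν} in
/-- Membership in `⌊u₁, u₂⌋` can be tested on a single arc. -/
theorem mem_bracket_iff {t u₁ u₂ : ν.rho} {a b : Fin n → M} (ha : T.typeOf a = p)
    (ht : Holds (ν.theta t) a b) :
    t ∈ ν.bracket u₁ u₂ ↔ ∃ c, Holds (ν.theta u₁) a c ∧ Holds (ν.theta u₂) c b := by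
  rw [← holds_comp]
  exact ⟨fun h => h M a ha b ht, fun h _ _ ha' _ ht' =>
    (sameType_of_mem_PF (ν.theta_mem_PF t) ha ha' ht ht' _).1 h⟩

theorem exists_arc (t : ν.rho) : ∃ (M : Theory.ModelType.{u, v, max u v} T) (a b : Fin n → M),
    T.typeOf a = p ∧ Holds (ν.theta t) a b := by
  obtain ⟨M, a, ha⟩ := T.exists_modelType_is_realized_in p
  obtain ⟨b, hb⟩ := (ν.theta_mem_PF t M a ha).1.1
  exact ⟨M, a, b, ha, hb⟩

/-- The composition of two labelled arcs is a labelled arc. Its label then belongs to the bracket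
of the two labels. -/
def ArcsCompose : Prop :=
  ∀ (M : Theory.ModelType.{u, v, max u v} T) (a b c : Fin n → M) (u₁ u₂ : ν.rho),
    T.typeOf a = p → Holds (ν.theta u₁) a b → Holds (ν.theta u₂) b c → ∃ t, Holds (ν.theta t) a c

theorem arcsCompose_of_transitive
    (h : ∀ (M : Theory.ModelType.{u, v, max u v} T) (a b c : {a : Fin n → M // T.typeOf a = p}),
      isolationRel p M a b → isolationRel p M b c → isolationRel p M a c) : ν.ArcsCompose := by
  intro M a b c u₁ u₂ ha hab hbc
  have hb := typeOf_of_holds ha hab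
  have hc := typeOf_of_holds hb hbc
  refine ν.exists_holds_theta ha hc (isolates_iff.1 ?_)
  exact h M ⟨a, ha⟩ ⟨b, hb⟩ ⟨c, hc⟩ (isolates_iff.2 (typeIsolated_of_holds ha hab))
    (isolates_iff.2 (typeIsolated_of_holds hb hbc))

variable {ν} in
theorem ArcsCompose.transitive (h : ν.ArcsCompose) {a b c : {a : Fin n → M // T.typeOf a = p}}
    (hab : isolationRel p M a b) (hbc : isolationRel p M b c) : isolationRel p M a c := by
  obtain ⟨u₁, h₁⟩ := ν.exists_holds_theta a.2 b.2 (isolates_iff.1 hab)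
  obtain ⟨u₂, h₂⟩ := ν.exists_holds_theta b.2 c.2 (isolates_iff.1 hbc)
  obtain ⟨t, ht⟩ := h M _ _ _ u₁ u₂ a.2 h₁ h₂
  exact isolates_iff.2 (typeIsolated_of_holds a.2 ht)

variable {ν} in
/-- If arcs compose, the brackets are finite by compactness: the labels of `⌊u₁, u₂⌋` cover the
compact set of types containing `θ_{u₁} ∘ θ_{u₂}`, and no label can be left out of the cover. -/
theorem ArcsCompose.isAlmostDeterministic (h : ν.ArcsCompose) : ν.IsAlmostDeterministic := by
  intro u₁ u₂
  constructor
  · obtain ⟨M, a, b, ha, hab⟩ := ν.exists_arc u₁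
    obtain ⟨c, hbc⟩ := (ν.theta_mem_PF u₂ M b (typeOf_of_holds ha hab)).1.1
    obtain ⟨t, ht⟩ := h M a b c u₁ u₂ ha hab hbc
    exact ⟨t, (mem_bracket_iff ha ht).2 ⟨b, hab, hbc⟩⟩
  · let K : Set (T.CompleteType (Fin n ⊕ Fin n)) :=
      (⋂ ψ : {ψ : L.Formula (Fin n) // Formula.equivSentence ψ ∈ p},
        T.typesWith (Formula.equivSentence (ψ.1.relabel Sum.inl : L.Formula (Fin n ⊕ Fin n)))) ∩
        T.typesWith (Formula.equivSentence (comp (ν.theta u₁) (ν.theta u₂)))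
    have hK : IsClosed K :=
      (isClosed_iInter fun _ => CompleteType.isClosed_typesWith _).inter
        (CompleteType.isClosed_typesWith _)
    have hcover : K ⊆ ⋃ t : ν.rho, T.typesWith (Formula.equivSentence (ν.theta t)) := by
      intro q hq
      obtain ⟨M, x, rfl⟩ := T.exists_modelType_is_realized_in q
      obtain ⟨N, a', ha'⟩ := T.exists_modelType_is_realized_in p
      have hx : x = Sum.elim (x ∘ Sum.inl) (x ∘ Sum.inr) := (Sum.elim_comp_inl_inr x).symm
      have key : ∀ ψ : L.Formula (Fin n), ψ.Realize a' → ψ.Realize (x ∘ Sum.inl) := by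
        intro ψ hψ
        have := Theory.CompleteType.formula_mem_typeOf.1 (Set.mem_iInter.1 hq.1
          ⟨ψ, ha' ▸ Theory.CompleteType.formula_mem_typeOf.2 hψ⟩)
        rwa [Formula.realize_relabel] at this
      have ha : T.typeOf (x ∘ Sum.inl) = p := by
        rw [← ha', eq_comm, typeOf_eq_iff]
        refine fun ψ => ⟨key ψ, fun hψ => ?_⟩
        by_contra hn
        exact key ψ.not hn hψ
      have hcomp := Theory.CompleteType.formula_mem_typeOf.1 hq.2
      rw [hx] at hcomp
      obtain ⟨b, hab, hbc⟩ := (holds_comp _ _ _ _).1 hcomp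
      obtain ⟨t, ht⟩ := h M _ _ _ u₁ u₂ ha hab hbc
      refine Set.mem_iUnion.2 ⟨t, Theory.CompleteType.formula_mem_typeOf.2 ?_⟩
      rw [hx]
      exact ht
    obtain ⟨s, hs⟩ := hK.isCompact.elim_finite_subcover _
      (fun _ => CompleteType.isOpen_typesWith _) hcover
    refine s.finite_toSet.subset fun t ht => ?_
    obtain ⟨M, a, b, ha, hab⟩ := ν.exists_arc t
    have hmem : T.typeOf (Sum.elim a b) ∈ K := by
      refine ⟨Set.mem_iInter.2 fun ψ => ?_,
        Theory.CompleteType.formula_mem_typeOf.2 (ht M a ha b hab)⟩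
      refine Theory.CompleteType.formula_mem_typeOf.2 ?_
      rw [Formula.realize_relabel]
      refine (Theory.CompleteType.formula_mem_typeOf (T := T)).1 ?_
      rw [Sum.elim_comp_inl, ha]
      exact ψ.2
    obtain ⟨t', ht's, ht'⟩ := Set.mem_iUnion₂.1 (hs hmem)
    rwa [eq_of_holds_theta ha hab (Theory.CompleteType.formula_mem_typeOf.1 ht')]

variable {ν} in
/-- Associativity and the unit `{0}` come from the associativity of the composition of relations;
closure of the composition of arcs supplies the intermediate labels. -/
theorem ArcsCompose.isMonoid (h : ν.ArcsCompose) : ν.IsMonoid := by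
  refine ⟨?_, fun X Y Z _ _ _ => Set.ext fun t => ⟨?_, ?_⟩, ?_⟩
  · rintro X Y ⟨x, hx⟩ ⟨y, hy⟩
    obtain ⟨t, ht⟩ := (h.isAlmostDeterministic x y).1
    exact ⟨t, x, hx, y, hy, ht⟩
  · rintro ⟨s, ⟨x, hx, y, hy, hs⟩, z, hz, ht⟩
    obtain ⟨M, a, d, ha, had⟩ := ν.exists_arc t
    obtain ⟨c, hac, hcd⟩ := (mem_bracket_iff ha had).1 ht
    obtain ⟨b, hab, hbc⟩ := (mem_bracket_iff ha hac).1 hs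
    have hb := typeOf_of_holds ha hab
    obtain ⟨r, hr⟩ := h M b c d y z hb hbc hcd
    exact ⟨x, hx, r, ⟨y, hy, z, hz, (mem_bracket_iff hb hr).2 ⟨c, hbc, hcd⟩⟩,
      (mem_bracket_iff ha had).2 ⟨b, hab, hr⟩⟩
  · rintro ⟨x, hx, s, ⟨y, hy, z, hz, hs⟩, ht⟩
    obtain ⟨M, a, d, ha, had⟩ := ν.exists_arc t
    obtain ⟨b, hab, hbd⟩ := (mem_bracket_iff ha had).1 ht
    have hb := typeOf_of_holds ha hab
    obtain ⟨c, hbc, hcd⟩ := (mem_bracket_iff hb hbd).1 hs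
    obtain ⟨r, hr⟩ := h M a b c x y ha hab hbc
    exact ⟨r, ⟨x, hx, y, hy, (mem_bracket_iff ha hr).2 ⟨b, hab, hbc⟩⟩, z, hz,
      (mem_bracket_iff ha had).2 ⟨c, hr, hcd⟩⟩
  · let φ₀ : PF p := ⟨eqFormula L n, eqFormula_mem_PF p⟩
    let e : ν.rho := ⟨ν.toFun (Quotient.mk (PE p) φ₀), _, rfl⟩
    have he : ∀ (M : Theory.ModelType.{u, v, max u v} T) (a b : Fin n → M), T.typeOf a = p →
        (Holds (ν.theta e) a b ↔ a = b) := fun M a b ha =>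
      (ν.holds_theta_iff φ₀ ha).trans (holds_eqFormula a b)
    have hl : ∀ s t : ν.rho, t ∈ ν.bracket e s ↔ t = s := by
      intro s t
      obtain ⟨M, a, b, ha, hab⟩ := ν.exists_arc t
      rw [mem_bracket_iff ha hab]
      constructor
      · rintro ⟨c, hac, hcb⟩
        obtain rfl := (he M a c ha).1 hac
        exact eq_of_holds_theta ha hab hcb
      · rintro rfl
        exact ⟨a, (he M a a ha).2 rfl, hab⟩
    have hr : ∀ s t : ν.rho, t ∈ ν.bracket s e ↔ t = s := by
      intro s t
      obtain ⟨M, a, b, ha, hab⟩ := ν.exists_arc t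
      rw [mem_bracket_iff ha hab]
      constructor
      · rintro ⟨c, hac, hcb⟩
        obtain rfl := (he M c b (typeOf_of_holds ha hac)).1 hcb
        exact eq_of_holds_theta ha hab hac
      · rintro rfl
        exact ⟨b, hab, (he M b b (typeOf_of_holds ha hab)).2 rfl⟩
    refine ⟨{e}, Set.singleton_nonempty e, fun X _ => ⟨?_, ?_⟩⟩ <;> ext t <;>
      simp [mul, hl, hr, -Subtype.exists]

/-- In a small theory, finiteness of the brackets makes arcs compose: otherwise
`θ_{u₁} ∘ θ_{u₂}` minus the finitely many labels of `⌊u₁, u₂⌋` would be consistent, and would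
contain an isolated type, whose label belongs to `⌊u₁, u₂⌋`. -/
theorem IsAlmostDeterministic.arcsCompose (hT : IsSmall T) {ν : RegularLabelling p A}
    (h : ν.IsAlmostDeterministic) : ν.ArcsCompose := by
  intro M a b c u₁ u₂ ha hab hbc
  by_contra hn
  have := (h u₁ u₂).2.to_subtype
  obtain ⟨χ, d, hd, hχ⟩ := hT.exists_isolatesBy a (b := c)
    (φ := comp (ν.theta u₁) (ν.theta u₂) ⊓
      Formula.iInf fun t : ν.bracket u₁ u₂ => (ν.theta t.1).not) (by
    rw [Formula.realize_inf, Formula.realize_iInf]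
    exact ⟨(holds_comp _ _ _ _).2 ⟨b, hab, hbc⟩, fun t ht => hn ⟨t, ht⟩⟩)
  rw [Formula.realize_inf, Formula.realize_iInf] at hd
  obtain ⟨b', hab', hbd'⟩ := (holds_comp _ _ _ _).1 hd.1
  obtain ⟨t, ht⟩ := ν.exists_holds_theta ha
    (typeOf_of_holds (typeOf_of_holds ha hab') hbd') ⟨χ, hχ⟩
  exact hd.2 ⟨t, (mem_bracket_iff ha ht).2 ⟨b', hab', hbd'⟩⟩ ht

/-- All labels are non-negative if and only if all arcs can be reversed: a class with an arc that
cannot be reversed is in `PFN(p)`, the other classes are in `PFS(p)`. -/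
theorem rho_subset_nonneg_iff : ν.rho ⊆ A.nonneg ↔
    ∀ (M : Theory.ModelType.{u, v, max u v} T) (a b : {a : Fin n → M // T.typeOf a = p}),
      isolationRel p M a b → isolationRel p M b a := by
  constructor
  · rintro h M ⟨a, ha⟩ ⟨b, hb⟩ hab
    by_contra hba
    obtain ⟨χ, hχ⟩ := isolates_iff.1 hab
    let φ : PF p := ⟨χ, hχ.mem_PF ha hb⟩
    have hneg := ν.map_PFN (Quotient.mk (PE p) φ) ⟨φ, rfl, M, a, b, ha, hχ.1, hba⟩
    rcases h ⟨Quotient.mk (PE p) φ, rfl⟩ with h | h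
    · exact A.zero_notMem_neg (Set.mem_singleton_iff.1 h ▸ hneg)
    · exact Set.disjoint_left.1 A.disjoint_neg_pos hneg h
  · rintro h _ ⟨E, rfl⟩
    induction E using Quotient.ind with | _ φ
    obtain ⟨M, a, ha⟩ := T.exists_modelType_is_realized_in p
    obtain ⟨b, hb⟩ := (φ.2 M a ha).1.1
    exact ν.map_PFS _ (mk_mem_PFS ha hb (h M ⟨a, ha⟩ ⟨b, (φ.2 M a ha).2 b hb⟩
      (isolates_iff.2 ⟨_, isolatesBy_of_mem_PF φ.2 ha hb⟩)))

end RegularLabelling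

/-! ### Limit models and symmetry of isolation -/

/-- If isolation is symmetric on the realizations of `p`, then a countable union of a chain of
models, each prime over a realization `a_k` of `p`, is prime over `a_0`: as `a_k` isolates `a_0`,
it is isolated by it, so that each model of the chain is atomic over `a_0`. -/
theorem not_isLimitOver_of_symmetric (hT : IsSmall T)
    (h : ∀ a b : {a : Fin n → M // T.typeOf a = p}, isolationRel p M a b → isolationRel p M b a) :
    ¬ IsLimitOver p M := by
  rintro ⟨hM, hprime, S, hS, hSM, hSa⟩
  choose a hap ha using hSa
  have hat : ∀ k, IsAtomicOver L (a k) := fun k =>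
    IsPrimeOver.isAtomicOver (T := T) (M := S k) hT (ha k)
  let a₀ : Fin n → M := fun i => a 0 i
  -- A tuple of `M` lying in `S k` is isolated over `a k`.
  have hiso : ∀ (k : ℕ) {m : Type} [Finite m] (d : m → M), (∀ i, d i ∈ S k) →
      TypeIsolated L (fun i => (a k i : M)) d := fun k m _ d hd =>
    (typeIsolated_map_iff (S k).subtype).2 ((hat k).typeIsolated fun i => ⟨d i, hd i⟩)
  refine hprime n a₀ (IsAtomicOver.isPrimeOver fun m d => ?_)
  choose s hs using fun i => hSM (d i)
  obtain ⟨k, hk⟩ := (Set.finite_range s).bddAbove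
  have hdk : ∀ i, d i ∈ S k := fun i => hS (hk ⟨i, rfl⟩) (hs i)
  have ha₀k : ∀ i, a₀ i ∈ S k := fun i => hS (Nat.zero_le k) (a 0 i).2
  have h₁ : TypeIsolated L a₀ fun i => (a k i : M) :=
    isolates_iff.1 (h ⟨_, hap k⟩ ⟨a₀, hap 0⟩ (isolates_iff.2 (hiso k a₀ ha₀k)))
  exact h₁.change_base (hiso k (Sum.elim a₀ d) (by rintro (i | i) <;> simp [hdk, ha₀k]))

/-- If isolation is not symmetric on the realizations of `p`, there is a limit model over `p`: if
`a` isolates `b` but not conversely, then a countable atomic model over `a` embeds into itself with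
`a` going to a tuple of the type of `b` over `a`. -/
theorem exists_isLimitOver_of_not_symmetric (hT : IsSmall T) {a b : Fin n → M}
    (ha : T.typeOf a = p) (hb : T.typeOf b = p) (hab : Isolates L a b) (hba : ¬ Isolates L b a) :
    ∃ N : Theory.ModelType.{u, v, max u v} T, IsLimitOver p N := by
  obtain ⟨S, hS, haS, hat⟩ := hT.exists_countable_atomic a
  let a' : Fin n → S := fun i => ⟨a i, haS i⟩
  have haa' : SameType L a a' := (sameType_elementaryEmbedding S.subtype a').symm
  have ha' : T.typeOf a' = p := (typeOf_eq_iff.2 haa').symm.trans ha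
  have hat' : IsAtomicOver L a' := fun k d =>
    (typeIsolated_map_iff S.subtype).1 (hat k (fun i => d i) fun i => (d i).2)
  obtain ⟨χ, hχ⟩ := isolates_iff.1 hab
  obtain ⟨b', hb'⟩ := (haa'.exists_iff χ).1 ⟨b, hχ.1⟩
  have hsame := hχ.sameType haa' hb'
  have ha'b' : SameType L a' b' :=
    haa'.symm.trans ((typeOf_eq_iff.1 (ha.trans hb.symm)).trans hsame.inr)
  obtain ⟨f, hf⟩ := hat'.isPrimeOver S b' ha'b'
  refine exists_isLimitOver hT ha' hat' (f := f) fun h => hba (isolates_iff.2 ?_)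
  rw [show f ∘ a' = b' from funext hf] at h
  refine h.transfer ?_
  simpa only [Sum.elim_swap] using (hsame.comp Sum.swap).symm

end Labels

end IsolatingFormulas

theorem corollary4p6 {L : FirstOrder.Language.{u, v}} {T : L.Theory} (hT : T.IsComplete)
    (hsmall : IsolatingFormulas.IsSmall T) {n : ℕ} (p : T.CompleteType (Fin n))
    {U : Type w} {A : IsolatingFormulas.LabelAlphabet U}
    (ν : IsolatingFormulas.RegularLabelling p A) :
    List.TFAE [
      ∀ M : FirstOrder.Language.Theory.ModelType.{u, v, max u v} T,
        Equivalence (IsolatingFormulas.isolationRel p M),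
      (ν.IsAlmostDeterministic ∧ ν.IsMonoid) ∧
        ¬ ∃ M : FirstOrder.Language.Theory.ModelType.{u, v, max u v} T,
          IsolatingFormulas.IsLimitOver p M,
      (ν.IsAlmostDeterministic ∧ ν.IsMonoid) ∧ ν.rho ⊆ A.nonneg] := by
  open IsolatingFormulas in
  tfae_have 1 → 2 := by
    intro h
    have hν : ν.ArcsCompose := ν.arcsCompose_of_transitive fun M _ _ _ => (h M).trans
    exact ⟨⟨hν.isAlmostDeterministic, hν.isMonoid⟩, fun ⟨M, hM⟩ =>
      not_isLimitOver_of_symmetric hsmall (fun _ _ => (h M).symm) hM⟩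
  tfae_have 2 → 3 := by
    rintro ⟨hν, hlim⟩
    refine ⟨hν, ν.rho_subset_nonneg_iff.2 fun M a b hab => ?_⟩
    by_contra hba
    exact hlim (exists_isLimitOver_of_not_symmetric hsmall a.2 b.2 hab hba)
  tfae_have 3 → 1 := by
    rintro ⟨⟨hν, -⟩, hpos⟩ M
    have hcomp := hν.arcsCompose hsmall
    refine ⟨fun a => isolates_iff.2 ⟨eqFormula L n, ?_⟩, ν.rho_subset_nonneg_iff.1 hpos M _ _,
      hcomp.transitive⟩
    exact isolatesBy_of_mem_PF (eqFormula_mem_PF p) a.2 ((holds_eqFormula _ _).2 rfl)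
  tfae_finish
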